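/- Let $\mathbb{F}_q$ be a finite field, let $A = (a_{ij}) \in \mathbb{F}_q^{m \times k}$ be an arbitrary matrix, and consider the (not necessarily balanced) linear system $$(\star)\qquad a_{i1}x_1 + \cdots + a_{ik}x_k = 0 \qquad (i = 1,\ldots,m)$$ in variables $x_1,\ldots,x_k \in \mathbb{F}_q^n$. A solution $(x_1,\ldots,x_k) \in (\mathbb{F}_q^n)^k$ of $(\star)$ is called linearly generic if every vector $c \in \mathbb{F}_q^k$ with $c_1x_1 + \cdots + c_kx_k = 0$ is a linear combination of the rows of $A$. Let $l \geq 1$ and let $b_1,\ldots,b_l \in \mathbb{F}_q \setminus \{0\}$ with $b_1 + \cdots + b_l = 0$. Then there are real constants $\beta,\gamma \geq 1$ with $\gamma < q$ (depending on $q$, $A$ and $b_1,\ldots,b_l$, but not on $n$) such that, for every $n$ and every subset $S \subseteq \mathbb{F}_q^n$ with $|S| \geq \beta\cdot\gamma^n$, the set $$\{\, b_1x_1 + \cdots + b_lx_l \;:\; x_1,\ldots,x_l \in S \text{ affinely independent} \,\} \cup \{0\}$$ contains a linearly generic solution of $(\star)$, i.e. there is a linearly generic solution $(y_1,\ldots,y_k)$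 of $(\star)$ all of whose entries $y_1,\ldots,y_k$ belong to this set. -/

import Mathlib

namespace LinearSystems

variable {F : Type*} [Field F]

/-- `(x₁, …, x_k)` is a solution in `F^n` of the homogeneous linear system with coefficient
matrix `A`, i.e. `a_{i1} x₁ + ⋯ + a_{ik} x_k = 0` for every row `i`. -/
def IsSolution {m k n : ℕ} (A : Matrix (Fin m) (Fin k) F) (x : Fin k → (Fin n → F)) : Prop :=
  ∀ i : Fin m, ∑ j : Fin k, A i j • x j = 0

/-- A solution `(x₁, …, x_k)` is linearly generic if every linear equation
`c₁ x₁ + ⋯ + c_k x_k = 0` over `F` that it satisfies is a linear combination of the equations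
of the system, i.e. `c` is a linear combination of the rows of `A`. -/
def IsLinearlyGenericSolution {m k n : ℕ} (A : Matrix (Fin m) (Fin k) F)
    (x : Fin k → (Fin n → F)) : Prop :=
  IsSolution A x ∧
    ∀ c : Fin k → F, ∑ j : Fin k, c j • x j = 0 →
      c ∈ Submodule.span F (Set.range fun i : Fin m => A i)

/-- The affinely independent restricted sumset of the dilates `b₁ · S, …, b_l · S`: all sums
`b₁ x₁ + ⋯ + b_l x_l` with `x₁, …, x_l ∈ S` affinely independent. -/
def airSumset {l n : ℕ} (b : Fin l → F) (S : Set (Fin n → F)) : Set (Fin n → F) :=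
  {y | ∃ x : Fin l → (Fin n → F),
    (∀ i, x i ∈ S) ∧ AffineIndependent F x ∧ y = ∑ i : Fin l, b i • x i}

end LinearSystems

/-! It suffices to find linearly independent `w₁, …, w_k` whose whole span lies in the sumset
together with `0`: if an endomorphism `f` of `F^k` has the row space of `A` as kernel, the vectors
`y_j = ∑ f(e_j)_s w_s` satisfy exactly the relations `c` with `f c = 0`. To find `w`, seek arrays
`z` and translates `p c`, common to all `i`, with `p c + ∑ c_s z_{is} ∈ S` for all `c ∈ F^k` and all
`i`. Since `∑ b_i = 0`, combining with weights `b` cancels `p c` and leaves `∑ c_s w_s`, where `w_s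
= ∑ b_i z_{is}`. Averaging over `p` yields arrays of density at least `(|S|/q^n)^(q^k l)`, while the
degenerate ones, with a vanishing contraction, have density at most `q^(k+l)/q^n`. Dense `S` makes
the first exceed the second. -/

namespace LinearSystems

/-- Averaging over translates: some translate `p` of a family `L : E → C → V` takes values in `S`
for at least the average number of parameters `z : E`. -/
theorem exists_translate_card_le {V C E : Type*} [AddCommGroup V] [Fintype V] [DecidableEq V]
    [Fintype C] [DecidableEq C] [Fintype E] (S : Finset V) (L : E → C → V) :
    ∃ p : C → V, S.card ^ Fintype.card C * Fintype.card E ≤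
      (Finset.univ.filter fun z : E => ∀ c, p c + L z c ∈ S).card *
        Fintype.card V ^ Fintype.card C := by
  -- For fixed `z`, adding `L z` permutes the functions `p`, so the number of good `p` does not
  -- depend on `z`; pairs `(p, z)` are then counted twice.
  have count (z : E) : (Finset.univ.filter fun p : C → V => ∀ c, p c + L z c ∈ S).card =
      S.card ^ Fintype.card C := by
    have h : (Fintype.piFinset fun _ : C => S).card = S.card ^ Fintype.card C := by simp
    rw [← h]
    refine Finset.card_bij' (fun p _ c => p c + L z c) (fun p _ c => p c - L z c) ?_ ?_ ?_ ?_ <;>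
      simp
  have total : ∑ p : C → V, (Finset.univ.filter fun z : E => ∀ c, p c + L z c ∈ S).card =
      S.card ^ Fintype.card C * Fintype.card E := by
    simp_rw [Finset.card_filter]
    rw [Finset.sum_comm]
    simp_rw [← Finset.card_filter, count]
    simp [mul_comm]
  by_contra! h
  have hlt := Finset.sum_lt_sum_of_nonempty (s := (Finset.univ : Finset (C → V)))
    Finset.univ_nonempty fun p _ => h p
  rw [← Finset.sum_mul, total] at hlt
  simp at hlt
  rw [mul_comm] at hlt
  exact lt_irrefl _ hlt

/-- A surjective homomorphism onto `V` has kernel of index `|V|`. -/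
theorem card_filter_eq_zero_mul_card {V U : Type*} [AddCommGroup V] [Fintype V] [DecidableEq V]
    [AddCommGroup U] [Fintype U] (φ : U →+ V) (hφ : Function.Surjective φ) :
    (Finset.univ.filter fun u => φ u = 0).card * Fintype.card V = Fintype.card U := by
  have h := φ.ker.card_mul_index
  rw [AddSubgroup.index_ker, AddMonoidHom.range_eq_top.mpr hφ] at h
  have hk : Nat.card φ.ker = (Finset.univ.filter fun u => φ u = 0).card := by
    rw [Nat.card_eq_fintype_card, ← Fintype.card_subtype]
    exact Fintype.card_congr (Equiv.refl _)
  rw [← hk, ← Nat.card_eq_fintype_card, ← Nat.card_eq_fintype_card, ← h]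
  simp

variable {F : Type*} [Field F]

/-- The contraction `z ↦ ∑ i, ∑ s, a i * c s • z i s` of an array of vectors. -/
def contraction {V : Type*} [AddCommGroup V] [Module F V] {k l : ℕ} (a : Fin l → F)
    (c : Fin k → F) : (Fin l → Fin k → V) →+ V where
  toFun z := ∑ i, a i • ∑ s, c s • z i s
  map_zero' := by simp
  map_add' x y := by simp [smul_add, Finset.sum_add_distrib]

theorem contraction_surjective {V : Type*} [AddCommGroup V] [Module F V] {k l : ℕ}
    {a : Fin l → F} {c : Fin k → F} (ha : a ≠ 0) (hc : c ≠ 0) :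
    Function.Surjective (contraction (V := V) a c) := by
  classical
  obtain ⟨i, hi⟩ := Function.ne_iff.mp ha
  obtain ⟨s, hs⟩ := Function.ne_iff.mp hc
  simp only [Pi.zero_apply] at hi hs
  intro v
  refine ⟨Pi.single i (Pi.single s ((a i * c s)⁻¹ • v)), ?_⟩
  change ∑ j, a j • ∑ t, c t • _ = v
  rw [Finset.sum_eq_single i, Finset.sum_eq_single s]
  · simp [smul_smul]
    field_simp
    simp
  · intro t _ ht
    simp [ht]
  · simp
  · intro j _ hj
    simp [hj]
  · simp

/-- Outside a proportion `|F| ^ (k + l) / |V|` of arrays `z`, no contraction of `z` with nonzero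
vectors vanishes; so every larger set contains an array without vanishing contractions. -/
theorem exists_forall_contraction_ne_zero {V : Type*} [AddCommGroup V] [Module F V] [Fintype F]
    [Fintype V] {k l : ℕ} (T : Finset (Fin l → Fin k → V))
    (hT : Fintype.card F ^ (k + l) * Fintype.card V ^ (k * l) < T.card * Fintype.card V) :
    ∃ z ∈ T, ∀ (a : Fin l → F) (c : Fin k → F), a ≠ 0 → c ≠ 0 → contraction a c z ≠ 0 := by
  classical
  by_contra! h
  have hsub : T ⊆ (Finset.univ.filter fun ac : (Fin l → F) × (Fin k → F) =>
      ac.1 ≠ 0 ∧ ac.2 ≠ 0).biUnion fun ac =>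
        Finset.univ.filter fun z => contraction ac.1 ac.2 z = 0 := by
    intro z hz
    obtain ⟨a, c, ha, hc, h0⟩ := h z hz
    simp only [Finset.mem_biUnion, Finset.mem_filter, Finset.mem_univ, true_and]
    exact ⟨(a, c), ⟨ha, hc⟩, h0⟩
  refine absurd hT (not_lt.mpr ?_)
  calc T.card * Fintype.card V
      ≤ (∑ ac ∈ Finset.univ.filter fun ac : (Fin l → F) × (Fin k → F) => ac.1 ≠ 0 ∧ ac.2 ≠ 0,
          (Finset.univ.filter fun z : Fin l → Fin k → V => contraction ac.1 ac.2 z = 0).card) *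
            Fintype.card V :=
        Nat.mul_le_mul_right _ ((Finset.card_le_card hsub).trans Finset.card_biUnion_le)
    _ = ∑ ac ∈ Finset.univ.filter fun ac : (Fin l → F) × (Fin k → F) => ac.1 ≠ 0 ∧ ac.2 ≠ 0,
          Fintype.card V ^ (k * l) := by
        rw [Finset.sum_mul]
        refine Finset.sum_congr rfl fun ac hac => ?_
        have hac := (Finset.mem_filter.mp hac).2
        refine (card_filter_eq_zero_mul_card (V := V) (U := Fin l → Fin k → V)
          (contraction ac.1 ac.2) (contraction_surjective hac.1 hac.2)).trans ?_
        simp [pow_mul]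
    _ ≤ ∑ ac : (Fin l → F) × (Fin k → F), Fintype.card V ^ (k * l) :=
        Finset.sum_le_sum_of_subset (Finset.filter_subset _ _)
    _ = _ := by
        simp [pow_add, mul_comm]

/-- If no contraction of `z` vanishes, the translates `p + c • z i` are affinely independent. -/
theorem affineIndependent_add_sum_smul {n k l : ℕ} {z : Fin l → Fin k → (Fin n → F)}
    (hz : ∀ (a : Fin l → F) (c : Fin k → F), a ≠ 0 → c ≠ 0 → contraction a c z ≠ 0)
    (p : Fin n → F) {c : Fin k → F} (hc : c ≠ 0) :
    AffineIndependent F fun i => p + ∑ s, c s • z i s := by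
  rw [affineIndependent_iff]
  intro t w hw hsum i hi
  classical
  by_contra hne
  -- The weights sum to zero, so `p` drops out, and extending them by zero off `t` gives a vanishing
  -- contraction.
  refine hz (fun j => if j ∈ t then w j else 0) c ?_ hc ?_
  · intro h0
    exact hne (by simpa [hi] using congrFun h0 i)
  · change ∑ j, (if j ∈ t then w j else 0) • ∑ s, c s • z j s = 0
    simp only [smul_add, Finset.sum_add_distrib, ← Finset.sum_smul, hw, zero_smul,
      zero_add] at hsum
    simpa [ite_smul, Finset.sum_ite_mem] using hsum

/-- A dense set `S` has an affinely independent restricted sumset which, together with `0`,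
contains the span of `k` linearly independent vectors. -/
theorem exists_linearIndependent_sum_smul_mem [Fintype F] {n k l : ℕ} {b : Fin l → F}
    (hb : b ≠ 0) (hsum : ∑ i, b i = 0) (S : Finset (Fin n → F))
    (hS : (Fintype.card F ^ (k + l)) * (Fintype.card F ^ n) ^ (Fintype.card F ^ k * l) <
      S.card ^ (Fintype.card F ^ k * l) * Fintype.card F ^ n) :
    ∃ w : Fin k → (Fin n → F), LinearIndependent F w ∧
      ∀ c : Fin k → F, ∑ s, c s • w s ∈ airSumset b (S : Set (Fin n → F)) ∪ {0} := by
  classical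
  obtain ⟨p, hp⟩ := exists_translate_card_le S
    fun (z : Fin k → (Fin n → F)) (c : Fin k → F) => ∑ s, c s • z s
  set Z := Finset.univ.filter fun z : Fin k → (Fin n → F) => ∀ c, p c + ∑ s, c s • z s ∈ S
    with hZ
  simp only [Fintype.card_pi, Finset.prod_const, Finset.card_univ, Fintype.card_fin] at hp
  set q := Fintype.card F
  have hq : 0 < q := Fintype.card_pos
  obtain ⟨z, hzZ, hz⟩ := exists_forall_contraction_ne_zero (F := F)
    (Fintype.piFinset fun _ : Fin l => Z) (by
      simp only [Fintype.card_piFinset, Finset.prod_const, Finset.card_univ, Fintype.card_fin,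
        Fintype.card_pi]
      change q ^ (k + l) * (q ^ n) ^ (k * l) < Z.card ^ l * q ^ n
      -- This factor clears the denominator of the averaging bound `hp` raised to the power `l`.
      refine lt_of_mul_lt_mul_right (a := (q ^ n) ^ (q ^ k * l)) ?_ (Nat.zero_le _)
      calc q ^ (k + l) * (q ^ n) ^ (k * l) * (q ^ n) ^ (q ^ k * l)
          = (q ^ (k + l) * (q ^ n) ^ (q ^ k * l)) * (q ^ n) ^ (k * l) := by ring
        _ < (S.card ^ (q ^ k * l) * q ^ n) * (q ^ n) ^ (k * l) :=
            Nat.mul_lt_mul_of_pos_right hS (by positivity)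
        _ = (S.card ^ q ^ k * (q ^ n) ^ k) ^ l * q ^ n := by
            rw [mul_pow, ← pow_mul, ← pow_mul]; ring
        _ ≤ (Z.card * (q ^ n) ^ q ^ k) ^ l * q ^ n := by gcongr
        _ = Z.card ^ l * q ^ n * (q ^ n) ^ (q ^ k * l) := by
            rw [mul_pow, ← pow_mul (q ^ n)]; ring)
  have hmem (i : Fin l) (c : Fin k → F) : p c + ∑ s, c s • z i s ∈ S :=
    (Finset.mem_filter.mp (Fintype.mem_piFinset.mp hzZ i)).2 c
  have hcontr (c : Fin k → F) : ∑ s, c s • ∑ i, b i • z i s = contraction b c z := by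
    change _ = ∑ i, b i • ∑ s, c s • z i s
    simp_rw [Finset.smul_sum]
    rw [Finset.sum_comm]
    exact Finset.sum_congr rfl fun i _ => Finset.sum_congr rfl fun s _ => smul_comm _ _ _
  refine ⟨fun s => ∑ i, b i • z i s, ?_, fun c => ?_⟩
  · rw [Fintype.linearIndependent_iff]
    intro c h0 s
    by_contra hne
    exact hz b c hb (fun h => hne (by simp [h])) ((hcontr c).symm.trans h0)
  -- For `c = 0` the points `p c + ∑ c_s z_{is}` all coincide, hence the adjoined `0`.
  · by_cases hc : c = 0
    · right; simp [hc]
    · left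
      refine ⟨fun i => p c + ∑ s, c s • z i s, fun i => hmem i c,
        affineIndependent_add_sum_smul hz (p c) hc, ?_⟩
      rw [hcontr]
      simp only [smul_add, Finset.sum_add_distrib, ← Finset.sum_smul, hsum, zero_smul, zero_add]
      rfl

/-- The span of `k` linearly independent vectors contains a linearly generic solution of every
linear system in `k` variables. -/
theorem exists_isLinearlyGenericSolution {m k n : ℕ} (A : Matrix (Fin m) (Fin k) F)
    {w : Fin k → (Fin n → F)} (hw : LinearIndependent F w) :
    ∃ B : Fin k → Fin k → F, IsLinearlyGenericSolution A fun j => ∑ s, B j s • w s := by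
  classical
  set R := Submodule.span F (Set.range fun i : Fin m => A i)
  obtain ⟨R', hR⟩ := R.exists_isCompl
  -- Projection onto a complement of `R` along `R`.
  obtain ⟨f, hf⟩ : ∃ f : (Fin k → F) →ₗ[F] (Fin k → F), LinearMap.ker f = R :=
    ⟨R'.subtype ∘ₗ R'.projectionOnto R hR.symm, by
      rw [LinearMap.ker_comp_of_ker_eq_bot _ R'.ker_subtype, Submodule.ker_projectionOnto]⟩
  have key (c : Fin k → F) :
      ∑ j, c j • ∑ s, f (Pi.single j 1) s • w s = ∑ s, f c s • w s := by
    have hc : f c = ∑ j, c j • f (Pi.single j 1) := by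
      conv_lhs => rw [pi_eq_sum_univ' c]
      simp [map_sum]
    simp_rw [hc, Finset.sum_apply, Pi.smul_apply, Finset.sum_smul, Finset.smul_sum, smul_smul,
      smul_eq_mul]
    rw [Finset.sum_comm]
  refine ⟨fun j => f (Pi.single j 1), fun i => ?_, fun c hc => ?_⟩
  · have hAi : f (A i) = 0 := by
      rw [← LinearMap.mem_ker, hf]
      exact Submodule.subset_span ⟨i, rfl⟩
    exact (key (A i)).trans (by simp [hAi])
  · change c ∈ R
    rw [← hf, LinearMap.mem_ker]
    exact funext (Fintype.linearIndependent_iff.mp hw _ ((key c).symm.trans hc))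

end LinearSystems

theorem corollaryD {F : Type*} [Field F] [Fintype F] {m k l : ℕ}
    (A : Matrix (Fin m) (Fin k) F) (b : Fin l → F) (hl : 0 < l)
    (hb : ∀ i, b i ≠ 0) (hsum : ∑ i, b i = 0) :
    ∃ β γ : ℝ, 1 ≤ β ∧ 1 ≤ γ ∧ γ < (Fintype.card F : ℝ) ∧
      ∀ (n : ℕ) (S : Finset (Fin n → F)), β * γ ^ n ≤ (S.card : ℝ) →
        ∃ y : Fin k → (Fin n → F),
          (∀ j, y j ∈ LinearSystems.airSumset b (S : Set (Fin n → F)) ∪ {0}) ∧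
          LinearSystems.IsLinearlyGenericSolution A y := by
  have hq : (1 : ℝ) < Fintype.card F := by exact_mod_cast Fintype.one_lt_card
  set q := Fintype.card F
  set N := q ^ k * l with hN
  have hNpos : 0 < N := Nat.mul_pos (pow_pos Fintype.card_pos k) hl
  have hN1 : (1 : ℝ) ≤ N := by exact_mod_cast hNpos
  have hinv : (N : ℝ)⁻¹ ≤ 1 := inv_le_one_of_one_le₀ hN1
  -- The exponent solves `γ ^ N * q = q ^ N`, the break-even point of the two densities as `n`
  -- grows.
  set γ : ℝ := (q : ℝ) ^ (1 - (N : ℝ)⁻¹) with hγ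
  have hγ0 : 0 < γ := by positivity
  have hγN : γ ^ N * q = (q : ℝ) ^ N := by
    have hq0 : (0 : ℝ) < q := by linarith
    rw [hγ, ← Real.rpow_mul_natCast hq0.le, sub_mul, one_mul, inv_mul_cancel₀ (by positivity),
      Real.rpow_sub_one hq0.ne', Real.rpow_natCast, div_mul_cancel₀ _ hq0.ne']
  -- Only `β ^ N > q ^ (k + l)` is needed of `β`; the `+ 1` makes it strict.
  refine ⟨(q : ℝ) ^ (k + l) + 1, γ, by simp,
    Real.one_le_rpow hq.le (by linarith), ?_, fun n S hS => ?_⟩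
  · calc γ < (q : ℝ) ^ (1 : ℝ) := Real.rpow_lt_rpow_of_exponent_lt hq (by
          have : 0 < (N : ℝ)⁻¹ := by positivity
          linarith)
      _ = q := Real.rpow_one _
  · have hdense : q ^ (k + l) * (q ^ n) ^ N < S.card ^ N * q ^ n := by
      have hβ : (q : ℝ) ^ (k + l) < ((q : ℝ) ^ (k + l) + 1) ^ N :=
        (lt_add_one _).trans_le (le_self_pow₀ (by simp) hNpos.ne')
      have : (q : ℝ) ^ (k + l) * ((q : ℝ) ^ n) ^ N < (S.card : ℝ) ^ N * (q : ℝ) ^ n := by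
        calc (q : ℝ) ^ (k + l) * ((q : ℝ) ^ n) ^ N
            < ((q : ℝ) ^ (k + l) + 1) ^ N * ((q : ℝ) ^ n) ^ N := by gcongr
          _ = (((q : ℝ) ^ (k + l) + 1) * γ ^ n) ^ N * (q : ℝ) ^ n := by
              rw [pow_right_comm, ← hγN]; simp only [mul_pow]; ring
          _ ≤ (S.card : ℝ) ^ N * (q : ℝ) ^ n := by gcongr
      exact_mod_cast this
    obtain ⟨w, hw, hmem⟩ := LinearSystems.exists_linearIndependent_sum_smul_mem (k := k)
      (fun h => hb ⟨0, hl⟩ (congrFun h _)) hsum S hdense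
    obtain ⟨B, hB⟩ := LinearSystems.exists_isLinearlyGenericSolution A hw
    exact ⟨_, fun j => hmem (B j), hB⟩
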